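/- For a positive integer $n$ write the $n$-th cyclotomic polynomial as $\Phi_n(x)=\sum_{k\ge 0}a_n(k)x^k$, with $a_n(k)=0$ for $k>\varphi(n)$. For an odd prime $p$, the Sister Beiter conjecture for $p$ asserts that $|a_{pqr}(k)|\le (p+1)/2$ for all primes $q,r$ with $p<q<r$ and all integers $k\ge 0$. The Sister Beiter conjecture is false for every prime $p\ge 11$. More precisely, for every prime $p\ge 11$ there exist primes $q,r$ with $p<q<r$ and an integer $k\ge 0$ such that $a_{pqr}(k)=(p+3)/2$. -/

import Mathlib

/-- The coefficient `a_n(k)` of `x^k` in the `n`-th cyclotomic polynomial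
(it is `0` for `k > φ(n)`). -/
noncomputable def cyclotomicCoeff (n k : ℕ) : ℤ :=
  (Polynomial.cyclotomic n ℤ).coeff k

/-- The Sister Beiter conjecture for the smallest prime factor `p`: for all primes `q`, `r` with
`p < q < r`, every coefficient of the ternary cyclotomic polynomial `Φ_{pqr}` has absolute value
at most `(p + 1) / 2` (a division of rational numbers). -/
def SisterBeiterConjecture (p : ℕ) : Prop :=
  ∀ q r : ℕ, q.Prime → r.Prime → p < q → q < r →
    ∀ k : ℕ, |(cyclotomicCoeff (p * q * r) k : ℚ)| ≤ ((p : ℚ) + 1) / 2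

/-! The method is Kaplan's. Dividing Φ_pqr(x)(1 - x^(pq)) = Φ_pq(x^r)(1 + … + x^(p-1))(1 - x^q) by 1
- x^(pq) as power series writes a_pqr(n) as Σ_{m<p} (b(c - mw) - b(c - (m+q)w)). Here w inverts r
mod pq, and b(x) is the coefficient of Φ_pq at the residue of x, replaced by 0 above a cutoff T. By
Dirichlet, c, T and any w coprime to pq can be prescribed
(`exists_cyclotomicCoeff_eq_sum_truncCoeff`).

The values of b are explicit (`coeff_cyclotomic_mul_prime`): with μp + lq = pq + 1, the residue ip +
jq carries 1 if i < μ and j < l, -1 if i ≥ μ and j ≥ l, and 0 otherwise.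

Take q ≡ (p-3)/2 mod p and w = ±(q - dp), so that each step moves (i, j) by (±d, ∓1). For a suitable
d, one of the two progressions meets only zeros, and the other meets exactly (p+3)/2 nonzero values,
all contributing +1. The residue of p mod 6 decides the sign of w and which progression contributes.
-/

/-! ### Coefficients of Φ_pq -/

open Polynomial in
theorem cyclotomic_mul_prime_mul_eq {p q : ℕ} (hp : p.Prime) (hq : q.Prime) (hpq : p ≠ q) :
    cyclotomic (p * q) ℤ * ((X ^ p - 1) * (X ^ q - 1)) = (X ^ (p * q) - 1) * (X - 1) := by
  have := Fact.mk hp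
  have hnd : ¬ q ∣ p := fun h => hpq ((Nat.prime_dvd_prime_iff_eq hq hp).1 h).symm
  have h1 := cyclotomic_expand_eq_cyclotomic_mul hq hnd ℤ
  have h2 := cyclotomic_prime_mul_X_sub_one ℤ p
  have h3 : expand ℤ q (cyclotomic p ℤ) * (X ^ q - 1) = X ^ (p * q) - 1 := by
    have := congrArg (expand ℤ q) h2
    simpa [pow_mul, ← pow_mul, mul_comm] using this
  rw [← h2, ← h3, h1]
  ring

open Polynomial in
/-- The explicit form of the cyclotomic polynomial of a product of two distinct primes. -/
theorem cyclotomic_mul_prime_eq_sub {p q μ l : ℕ} (hp : p.Prime) (hq : q.Prime) (hpq : p ≠ q)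
    (hμ : μ ≤ q) (hl : l ≤ p) (h : μ * p + l * q = p * q + 1) :
    cyclotomic (p * q) ℤ =
      (∑ i ∈ Finset.range μ, (X ^ p) ^ i) * (∑ j ∈ Finset.range l, (X ^ q) ^ j) -
        X * ((∑ i ∈ Finset.range (q - μ), (X ^ p) ^ i) *
          (∑ j ∈ Finset.range (p - l), (X ^ q) ^ j)) := by
  have hne : ((X ^ p - 1) * (X ^ q - 1) : ℤ[X]) ≠ 0 :=
    mul_ne_zero (X_pow_sub_C_ne_zero hp.pos 1) (X_pow_sub_C_ne_zero hq.pos 1)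
  apply mul_right_cancel₀ hne
  rw [cyclotomic_mul_prime_mul_eq hp hq hpq]
  obtain ⟨μ', hqdef⟩ := Nat.exists_eq_add_of_le hμ
  obtain ⟨l', hpdef⟩ := Nat.exists_eq_add_of_le hl
  rw [show q - μ = μ' by omega, show p - l = l' by omega]
  have e1 := geom_sum_mul (X ^ p : ℤ[X]) μ
  have e2 := geom_sum_mul (X ^ q : ℤ[X]) l
  have e3 := geom_sum_mul (X ^ p : ℤ[X]) μ'
  have e4 := geom_sum_mul (X ^ q : ℤ[X]) l'
  simp only [← pow_mul] at e1 e2 e3 e4 ⊢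
  have f1 : p * μ + p * μ' = p * q := by rw [hqdef, mul_add]
  have f2 : q * l + q * l' = p * q := by rw [← mul_add, ← hpdef, mul_comm]
  have g1 : (X ^ (p * μ) * X ^ (q * l) : ℤ[X]) = X ^ (p * q) * X := by
    rw [← pow_add, ← pow_succ]; congr 1; linarith
  -- The relation μp + lq = pq + 1 also reads 1 + p(q - μ) = lq and 1 + q(p - l) = μp.
  have g2 : (X * X ^ (p * μ') : ℤ[X]) = X ^ (q * l) := by
    rw [← pow_succ']; congr 1; linarith
  have g3 : (X * X ^ (q * l') : ℤ[X]) = X ^ (p * μ) := by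
    rw [← pow_succ']; congr 1; linarith
  have g4 : (X ^ (q * l) * X ^ (q * l') : ℤ[X]) = X ^ (p * q) := by
    rw [← pow_add, f2]
  calc ((X ^ (p * q) - 1) * (X - 1) : ℤ[X])
      = (X ^ (p * μ) - 1) * (X ^ (q * l) - 1) -
          X * ((X ^ (p * μ') - 1) * (X ^ (q * l') - 1)) := by
        linear_combination (-1 : ℤ[X]) * g1 + (X ^ (q * l') - 1 : ℤ[X]) * g2 - g3 + g4
    _ = _ := by
        rw [← e1, ← e2, ← e3, ← e4]; ring

theorem eq_of_add_modEq_mul {p q i j i' j' : ℤ} (hpq : IsCoprime p q)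
    (hi : 0 ≤ i ∧ i < q) (hj : 0 ≤ j ∧ j < p) (hi' : 0 ≤ i' ∧ i' < q) (hj' : 0 ≤ j' ∧ j' < p)
    (h : i * p + j * q ≡ i' * p + j' * q [ZMOD p * q]) : i = i' ∧ j = j' := by
  obtain ⟨d, hd⟩ := h.dvd
  constructor
  · have : q ∣ (i' - i) := hpq.symm.dvd_of_dvd_mul_right ⟨p * d - (j' - j), by linear_combination hd⟩
    obtain ⟨e, he⟩ := this
    have h1 : e < 1 := by nlinarith
    have h2 : -1 < e := by nlinarith
    have : e = 0 := by omega
    subst this; omega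
  · have : p ∣ (j' - j) := hpq.dvd_of_dvd_mul_right ⟨q * d - (i' - i), by linear_combination hd⟩
    obtain ⟨e, he⟩ := this
    have h1 : e < 1 := by nlinarith
    have h2 : -1 < e := by nlinarith
    have : e = 0 := by omega
    subst this; omega

open Polynomial in
theorem coeff_geom_sum_mul_geom_sum (p q a b t : ℕ) :
    ((∑ i ∈ Finset.range a, (X ^ p : ℤ[X]) ^ i) * (∑ j ∈ Finset.range b, (X ^ q) ^ j)).coeff t =
      ∑ i ∈ Finset.range a, ∑ j ∈ Finset.range b, if t = i * p + j * q then 1 else 0 := by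
  simp only [Finset.sum_mul_sum, finsetSum_coeff, ← pow_mul, ← pow_add, coeff_X_pow,
    mul_comm p, mul_comm q]

open Polynomial in
theorem coeff_X_mul_geom_sum_mul_geom_sum (p q a b t : ℕ) :
    (X * ((∑ i ∈ Finset.range a, (X ^ p : ℤ[X]) ^ i) *
        (∑ j ∈ Finset.range b, (X ^ q) ^ j))).coeff t =
      ∑ i ∈ Finset.range a, ∑ j ∈ Finset.range b, if t = 1 + i * p + j * q then 1 else 0 := by
  rw [Finset.sum_mul_sum]
  simp only [Finset.mul_sum, finsetSum_coeff]
  refine Finset.sum_congr rfl fun i _ => Finset.sum_congr rfl fun j _ => ?_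
  rw [← pow_mul, ← pow_mul, ← pow_add, ← pow_succ', coeff_X_pow]
  congr 2
  ring

theorem sum_range_sum_range_ite (a b : ℕ) (i j : ℤ) (P : ℕ → ℕ → Prop) [∀ x y, Decidable (P x y)]
    (hP : ∀ x < a, ∀ y < b, P x y ↔ ((x : ℤ) = i ∧ (y : ℤ) = j)) :
    (∑ x ∈ Finset.range a, ∑ y ∈ Finset.range b, if P x y then (1 : ℤ) else 0) =
      if (0 ≤ i ∧ i < a) ∧ (0 ≤ j ∧ j < b) then 1 else 0 := by
  split_ifs with h
  · obtain ⟨⟨h1, h2⟩, h3, h4⟩ := h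
    lift i to ℕ using h1
    lift j to ℕ using h3
    rw [Finset.sum_eq_single i, Finset.sum_eq_single j]
    · rw [if_pos ((hP i (by omega) j (by omega)).2 ⟨rfl, rfl⟩)]
    · intro y hy hne
      rw [Finset.mem_range] at hy
      rw [if_neg]
      rw [hP i (by omega) y hy]
      omega
    · intro hj; simp at hj; omega
    · intro x hx hne
      rw [Finset.mem_range] at hx
      apply Finset.sum_eq_zero
      intro y hy
      rw [Finset.mem_range] at hy
      rw [if_neg]
      rw [hP x hx y hy]
      omega
    · intro hj; simp at hj; omega
  · apply Finset.sum_eq_zero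
    intro x hx
    apply Finset.sum_eq_zero
    intro y hy
    rw [Finset.mem_range] at hx hy
    rw [if_neg]
    rw [hP x hx y hy]
    omega

/-- The coefficient of the cyclotomic polynomial of `p * q` at the residue of `i * p + j * q`. -/
theorem coeff_cyclotomic_mul_prime {p q μ l : ℕ} (hp : p.Prime) (hq : q.Prime) (hpq : p ≠ q)
    (hμ : μ ≤ q) (hl : l ≤ p) (h : μ * p + l * q = p * q + 1) {i j : ℤ} {t : ℕ}
    (ht : t < p * q) (hi : 0 ≤ i ∧ i < q) (hj : 0 ≤ j ∧ j < p)
    (hc : (t : ℤ) ≡ i * p + j * q [ZMOD p * q]) :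
    (Polynomial.cyclotomic (p * q) ℤ).coeff t =
      (if i < μ ∧ j < l then 1 else 0) - (if μ ≤ i ∧ l ≤ j then 1 else 0) := by
  have hco : IsCoprime (p : ℤ) q := Nat.isCoprime_iff_coprime.2 ((Nat.coprime_primes hp hq).2 hpq)
  have hz : (μ : ℤ) * p + l * q = p * q + 1 := by exact_mod_cast h
  have hp0 := hp.pos
  have hq0 := hq.pos
  have key : ∀ v : ℤ, 0 ≤ v → v < p * q → ((t : ℤ) = v ↔ v ≡ i * p + j * q [ZMOD p * q]) := by
    intro v h0 h1
    constructor
    · rintro rfl; exact hc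
    · intro hv
      have := hc.trans hv.symm
      have ht' : (t : ℤ) < p * q := by exact_mod_cast ht
      rwa [Int.ModEq, Int.emod_eq_of_lt (by positivity) ht', Int.emod_eq_of_lt h0 h1] at this
  rw [cyclotomic_mul_prime_eq_sub hp hq hpq hμ hl h, Polynomial.coeff_sub,
    coeff_geom_sum_mul_geom_sum, coeff_X_mul_geom_sum_mul_geom_sum]
  rw [sum_range_sum_range_ite μ l i j, sum_range_sum_range_ite (q - μ) (p - l) (i - μ) (j - l)]
  · congr 1
    · congr 1
      simp [hi, hj]
    · congr 1
      rw [Nat.cast_sub hμ, Nat.cast_sub hl]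
      apply propext
      omega
  · intro x hx y hy
    have hx' : (x : ℤ) + μ + 1 ≤ q := by omega
    have hy' : (y : ℤ) + l + 1 ≤ p := by omega
    have := key (1 + x * p + y * q) (by positivity) (by
      have a1 := mul_le_mul_of_nonneg_right hx' (Nat.cast_nonneg (α := ℤ) p)
      have a2 := mul_le_mul_of_nonneg_right hy' (Nat.cast_nonneg (α := ℤ) q)
      have a3 : (0 : ℤ) < p := by exact_mod_cast hp0
      have a4 : (0 : ℤ) < q := by exact_mod_cast hq0
      linarith)
    rw [← Nat.cast_inj (R := ℤ)]
    push_cast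
    rw [this]
    -- The negative block is the quadrant i ≥ μ, j ≥ l, shifted down by pq.
    have e : (1 + x * p + y * q : ℤ) = ((x + μ : ℤ) * p + (y + l : ℤ) * q) - p * q := by
      linear_combination -hz
    rw [e]
    constructor
    · intro hm
      have hm' : ((x + μ : ℤ) * p + (y + l : ℤ) * q) ≡ i * p + j * q [ZMOD p * q] := by
        refine Int.ModEq.trans ?_ hm
        exact (Int.modEq_iff_dvd.2 ⟨-1, by ring⟩)
      have := eq_of_add_modEq_mul hco ⟨by positivity, by omega⟩ ⟨by positivity, by omega⟩ hi hj hm'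
      omega
    · rintro ⟨h1, h2⟩
      rw [h1, h2]
      exact (Int.modEq_iff_dvd.2 ⟨1, by ring⟩)
  · intro x hx y hy
    have hx' : (x : ℤ) + 1 ≤ μ := by omega
    have hy' : (y : ℤ) + 1 ≤ l := by omega
    have := key (x * p + y * q) (by positivity) (by
      have a1 := mul_le_mul_of_nonneg_right hx' (Nat.cast_nonneg (α := ℤ) p)
      have a2 := mul_le_mul_of_nonneg_right hy' (Nat.cast_nonneg (α := ℤ) q)
      have a3 : (1 : ℤ) ≤ p := by exact_mod_cast hp0
      have a4 : (1 : ℤ) ≤ q := by exact_mod_cast hq0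
      linarith)
    rw [← Nat.cast_inj (R := ℤ)]
    push_cast
    rw [this]
    constructor
    · intro hm
      exact eq_of_add_modEq_mul hco ⟨by positivity, by omega⟩ ⟨by positivity, by omega⟩ hi hj hm
    · rintro ⟨h1, h2⟩
      rw [h1, h2]

/-! ### Truncated coefficients of Φ_pq -/

/-- The coefficient of the cyclotomic polynomial of `n` at the residue of `x` modulo `n`, if that
residue is at most `T`, and `0` otherwise. -/
noncomputable def truncCoeff (n T : ℕ) (x : ℤ) : ℤ :=
  if (x % n).toNat ≤ T then (Polynomial.cyclotomic n ℤ).coeff (x % n).toNat else 0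

theorem truncCoeff_eq_zero_of_lt {n T : ℕ} {x : ℤ} (h : (T : ℤ) < x) (hx : x < n) :
    truncCoeff n T x = 0 := by
  rw [truncCoeff, if_neg]
  rw [Int.emod_eq_of_lt (by omega) hx]
  omega

theorem truncCoeff_congr {n T : ℕ} {x y : ℤ} (h : x ≡ y [ZMOD n]) :
    truncCoeff n T x = truncCoeff n T y := by
  rw [truncCoeff, truncCoeff, h]

section

variable {p q μ l : ℕ}

theorem truncCoeff_mul_prime (hp : p.Prime) (hq : q.Prime) (hpq : p ≠ q)
    (hμ : μ ≤ q) (hl : l ≤ p) (h : μ * p + l * q = p * q + 1) {i j x : ℤ} (T : ℕ)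
    (hi : 0 ≤ i ∧ i < q) (hj : 0 ≤ j ∧ j < p) (hc : x ≡ i * p + j * q [ZMOD p * q]) :
    truncCoeff (p * q) T x = if (x % (p * q)).toNat ≤ T then
      (if i < μ ∧ j < l then 1 else 0) - (if μ ≤ i ∧ l ≤ j then 1 else 0) else 0 := by
  have hpos : (0 : ℤ) < p * q := by exact_mod_cast Nat.mul_pos hp.pos hq.pos
  have h0 := Int.emod_nonneg x hpos.ne'
  have h1 := Int.emod_lt_of_pos x hpos
  rw [truncCoeff, Nat.cast_mul]
  congr 1
  apply coeff_cyclotomic_mul_prime hp hq hpq hμ hl h _ hi hj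
  · rw [Int.toNat_of_nonneg h0]
    exact (Int.mod_modEq _ _).trans hc
  · zify
    rwa [Int.toNat_of_nonneg h0]

/-- In the two mixed quadrants the coefficient itself vanishes, so neither the cutoff nor the size
of x matters. -/
theorem truncCoeff_eq_zero (hp : p.Prime) (hq : q.Prime) (hpq : p ≠ q)
    (hμ : μ ≤ q) (hl : l ≤ p) (h : μ * p + l * q = p * q + 1) {i j x : ℤ} (T : ℕ)
    (hi : 0 ≤ i ∧ i < q) (hj : 0 ≤ j ∧ j < p) (hc : x ≡ i * p + j * q [ZMOD p * q])
    (hij : i < μ ∧ l ≤ j ∨ μ ≤ i ∧ j < l) : truncCoeff (p * q) T x = 0 := by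
  rw [truncCoeff_mul_prime hp hq hpq hμ hl h T hi hj hc, if_neg (show ¬ (i < μ ∧ j < l) by omega),
    if_neg (show ¬ (μ ≤ i ∧ l ≤ j) by omega)]
  simp

/-- The relation for μ and l forces 0 ≤ x < pq on this quadrant, so x is its own residue and only x
≤ T has to be checked. -/
theorem truncCoeff_eq_one (hp : p.Prime) (hq : q.Prime) (hpq : p ≠ q)
    (hμ : μ ≤ q) (hl : l ≤ p) (h : μ * p + l * q = p * q + 1) {i j x : ℤ} {T : ℕ}
    (hi : 0 ≤ i ∧ i < μ) (hj : 0 ≤ j ∧ j < l) (hc : x = i * p + j * q) (hT : x ≤ T) :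
    truncCoeff (p * q) T x = 1 := by
  have hz : (μ : ℤ) * p + l * q = p * q + 1 := by exact_mod_cast h
  have hx : x < p * q := by
    have a1 := mul_le_mul_of_nonneg_right (show i + 1 ≤ μ by omega) (Nat.cast_nonneg (α := ℤ) p)
    have a2 := mul_le_mul_of_nonneg_right (show j + 1 ≤ l by omega) (Nat.cast_nonneg (α := ℤ) q)
    have a3 : (1 : ℤ) ≤ p := by exact_mod_cast hp.pos
    have a4 : (1 : ℤ) ≤ q := by exact_mod_cast hq.pos
    linarith
  have hx0 : 0 ≤ x := by
    rw [hc]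
    exact add_nonneg (mul_nonneg hi.1 (by positivity)) (mul_nonneg hj.1 (by positivity))
  rw [truncCoeff_mul_prime hp hq hpq hμ hl h T (i := i) (j := j) (by omega) (by omega)
    (hc ▸ Int.ModEq.refl _), Int.emod_eq_of_lt hx0 hx, if_pos (by omega), if_pos (by omega),
    if_neg (by omega)]
  simp

theorem truncCoeff_eq_neg_one (hp : p.Prime) (hq : q.Prime) (hpq : p ≠ q)
    (hμ : μ ≤ q) (hl : l ≤ p) (h : μ * p + l * q = p * q + 1) {i j x : ℤ} {T : ℕ}
    (hi : μ ≤ i ∧ i < q) (hj : l ≤ j ∧ j < p) (hc : x = i * p + j * q - p * q) (hT : x ≤ T) :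
    truncCoeff (p * q) T x = -1 := by
  have hz : (μ : ℤ) * p + l * q = p * q + 1 := by exact_mod_cast h
  have a3 : (1 : ℤ) ≤ p := by exact_mod_cast hp.pos
  have a4 : (1 : ℤ) ≤ q := by exact_mod_cast hq.pos
  have hx : x < p * q := by
    have a1 := mul_le_mul_of_nonneg_right (show i + 1 ≤ q by omega) (Nat.cast_nonneg (α := ℤ) p)
    have a2 := mul_le_mul_of_nonneg_right (show j + 1 ≤ p by omega) (Nat.cast_nonneg (α := ℤ) q)
    linarith
  have hx0 : 0 ≤ x := by
    have a1 := mul_le_mul_of_nonneg_right hi.1 (Nat.cast_nonneg (α := ℤ) p)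
    have a2 := mul_le_mul_of_nonneg_right hj.1 (Nat.cast_nonneg (α := ℤ) q)
    linarith
  rw [truncCoeff_mul_prime hp hq hpq hμ hl h T (i := i) (j := j) (by omega) (by omega)
    (Int.modEq_iff_dvd.2 ⟨1, by rw [hc]; ring⟩), Int.emod_eq_of_lt hx0 hx, if_pos (by omega),
    if_neg (by omega), if_pos (by omega)]
  simp

end

/-! ### Kaplan's formula for ternary coefficients -/

open PowerSeries in
theorem mk_ite_dvd_mul_one_sub_X_pow {N : ℕ} (hN : 0 < N) :
    (PowerSeries.mk fun n => if N ∣ n then (1 : ℤ) else 0) * (1 - X ^ N) = 1 := by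
  ext n
  rw [mul_sub, mul_one, map_sub, coeff_mul_X_pow', coeff_mk, coeff_one]
  by_cases h : N ≤ n
  · have hn : n ≠ 0 := by omega
    have hd : N ∣ n - N ↔ N ∣ n := by
      rw [Nat.dvd_sub_iff_left h (dvd_refl N)]
    simp [h, hn, hd]
  · rw [if_neg h]
    rcases Nat.eq_zero_or_pos n with rfl | hn
    · simp
    · rw [if_neg (fun hd => h (Nat.le_of_dvd hn hd)), if_neg hn.ne']; simp

open PowerSeries in
theorem coeff_X_pow_mul_mk_ite_dvd (N a n : ℕ) :
    coeff n (X ^ a * PowerSeries.mk fun n => if N ∣ n then (1 : ℤ) else 0) =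
      if a ≤ n ∧ (N : ℤ) ∣ (n : ℤ) - a then 1 else 0 := by
  rw [coeff_X_pow_mul']
  by_cases h : a ≤ n
  · rw [if_pos h, coeff_mk]
    simp only [h, true_and, ← Nat.cast_sub h, Int.natCast_dvd_natCast]
  · simp [h]

-- Combines Φ_pq(x^r) = Φ_pqr(x)Φ_pq(x) with Φ_pq(x)(x^p - 1)(x^q - 1) = (x^(pq) - 1)(x - 1), after
-- multiplying by x - 1.
open Polynomial in
theorem cyclotomic_mul_prime_mul_prime_mul_eq {p q r : ℕ} (hp : p.Prime) (hq : q.Prime)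
    (hr : r.Prime) (hpq : p ≠ q) (hpr : p ≠ r) (hqr : q ≠ r) :
    cyclotomic (p * q * r) ℤ * (1 - X ^ (p * q)) =
      expand ℤ r (cyclotomic (p * q) ℤ) *
        (∑ m ∈ Finset.range p, X ^ m - ∑ m ∈ Finset.range p, X ^ (m + q)) := by
  have hnd : ¬ r ∣ p * q := fun h => by
    rcases hr.dvd_mul.1 h with h | h
    · exact hpr ((Nat.prime_dvd_prime_iff_eq hr hp).1 h).symm
    · exact hqr ((Nat.prime_dvd_prime_iff_eq hr hq).1 h).symm
  have h1 := cyclotomic_expand_eq_cyclotomic_mul hr hnd ℤ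
  have h2 := cyclotomic_mul_prime_mul_eq hp hq hpq
  have h3 := geom_sum_mul (X : ℤ[X]) p
  have hX : (X - 1 : ℤ[X]) ≠ 0 := X_sub_C_ne_zero 1
  apply mul_right_cancel₀ hX
  rw [h1]
  simp only [pow_add, ← Finset.sum_mul]
  linear_combination cyclotomic (p * q * r) ℤ * h2 -
    cyclotomic (p * q * r) ℤ * cyclotomic (p * q) ℤ * (1 - X ^ q) * h3

open PowerSeries in
theorem coeff_cyclotomic_mul_prime_mul_prime {p q r : ℕ} (hp : p.Prime) (hq : q.Prime)
    (hr : r.Prime) (hpq : p ≠ q) (hpr : p ≠ r) (hqr : q ≠ r) (n : ℕ) :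
    (Polynomial.cyclotomic (p * q * r) ℤ).coeff n =
      ∑ t ∈ Finset.range (p * q), (Polynomial.cyclotomic (p * q) ℤ).coeff t *
        ∑ m ∈ Finset.range p,
          ((if r * t + m ≤ n ∧ ((p * q : ℕ) : ℤ) ∣ (n : ℤ) - (r * t + m : ℕ) then 1 else 0) -
            if r * t + (m + q) ≤ n ∧ ((p * q : ℕ) : ℤ) ∣ (n : ℤ) - (r * t + (m + q) : ℕ)
              then 1 else 0) := by
  have hN : 0 < p * q := Nat.mul_pos hp.pos hq.pos
  set E : PowerSeries ℤ := PowerSeries.mk fun n => if p * q ∣ n then (1 : ℤ) else 0 with hE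
  have h1 := congrArg (fun f : Polynomial ℤ => (f : PowerSeries ℤ) * E)
    (cyclotomic_mul_prime_mul_prime_mul_eq hp hq hr hpq hpr hqr)
  have hdeg : (Polynomial.cyclotomic (p * q) ℤ).natDegree < p * q := by
    rw [Polynomial.natDegree_cyclotomic]
    exact Nat.totient_lt _ (by nlinarith [hp.two_le, hq.two_le])
  have h2 : Polynomial.expand ℤ r (Polynomial.cyclotomic (p * q) ℤ) =
      ∑ t ∈ Finset.range (p * q),
        Polynomial.C ((Polynomial.cyclotomic (p * q) ℤ).coeff t) * Polynomial.X ^ (r * t) := by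
    conv_lhs => rw [Polynomial.as_sum_range_C_mul_X_pow' _ hdeg]
    simp [pow_mul]
  have h3 : ((Polynomial.cyclotomic (p * q * r) ℤ : Polynomial ℤ) : PowerSeries ℤ) =
      ∑ t ∈ Finset.range (p * q), C ((Polynomial.cyclotomic (p * q) ℤ).coeff t) *
        ∑ m ∈ Finset.range p, (X ^ (r * t + m) * E - X ^ (r * t + (m + q)) * E) := by
    have hE1 := mk_ite_dvd_mul_one_sub_X_pow hN
    rw [← hE] at hE1
    rw [h2] at h1
    have hs : ∀ (s : Finset ℕ) (f : ℕ → Polynomial ℤ),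
        ((∑ i ∈ s, f i : Polynomial ℤ) : PowerSeries ℤ) = ∑ i ∈ s, (f i : PowerSeries ℤ) :=
      fun s f => map_sum (Polynomial.coeToPowerSeries.ringHom (R := ℤ)) f s
    simp only [Polynomial.coe_mul, Polynomial.coe_sub, Polynomial.coe_one, Polynomial.coe_pow,
      Polynomial.coe_X, Polynomial.coe_C, hs] at h1
    rw [mul_assoc, mul_comm (1 - X ^ (p * q)), hE1, mul_one] at h1
    rw [h1, mul_assoc, Finset.sum_mul]
    refine Finset.sum_congr rfl fun t _ => ?_
    rw [← Finset.sum_sub_distrib, Finset.sum_mul, mul_assoc, Finset.mul_sum]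
    congr 1
    refine Finset.sum_congr rfl fun m _ => ?_
    rw [pow_add _ (r * t), pow_add _ (r * t)]
    ring
  rw [← Polynomial.coeff_coe, h3, map_sum]
  refine Finset.sum_congr rfl fun t _ => ?_
  rw [coeff_C_mul, map_sum]
  congr 1
  refine Finset.sum_congr rfl fun m _ => ?_
  rw [map_sub, coeff_X_pow_mul_mk_ite_dvd, coeff_X_pow_mul_mk_ite_dvd]

/-- For fixed m the congruence leaves a single t < N, namely the residue of c - mw. Since n lies in
[rT, rT + N) and r ≥ N, the condition rt + m ≤ n then amounts to t ≤ T. -/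
theorem sum_range_coeff_mul_ite {N T r m n : ℕ} {w c : ℤ} (hN : 0 < N)
    (hw : r * w ≡ 1 [ZMOD N]) (hc : (n : ℤ) ≡ r * c [ZMOD N]) (hm : m < N)
    (hrN : N ≤ r) (h1 : r * T ≤ n) (h2 : n < r * T + N) :
    ∑ t ∈ Finset.range N, (Polynomial.cyclotomic N ℤ).coeff t *
        (if r * t + m ≤ n ∧ (N : ℤ) ∣ (n : ℤ) - (r * t + m : ℕ) then 1 else 0) =
      truncCoeff N T (c - m * w) := by
  have hN' : (0 : ℤ) < N := by exact_mod_cast hN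
  have h3 := Int.emod_nonneg (c - m * w) hN'.ne'
  have h4 := Int.emod_lt_of_pos (c - m * w) hN'
  have hiff : ∀ t < N, (r * t + m ≤ n ∧ (N : ℤ) ∣ (n : ℤ) - (r * t + m : ℕ)) ↔
      t = ((c - m * w) % N).toNat ∧ t ≤ T := by
    intro t ht
    have e1 : (N : ℤ) ∣ (n : ℤ) - (r * t + m : ℕ) ↔ t = ((c - m * w) % N).toNat := by
      have e2 : t = ((c - m * w) % N).toNat ↔ (t : ℤ) ≡ c - m * w [ZMOD N] := by
        have ht' := Int.emod_eq_of_lt (Nat.cast_nonneg (α := ℤ) t) (by exact_mod_cast ht : (t : ℤ) < N)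
        rw [Int.ModEq, ht']
        omega
      rw [e2]
      obtain ⟨a, ha⟩ := hw.dvd
      obtain ⟨b, hb⟩ := hc.dvd
      constructor
      · rintro ⟨d, hd⟩
        push_cast at hd
        apply Int.modEq_iff_dvd.2
        exact ⟨w * b + w * d + a * (c - t), by
          linear_combination w * hb + w * hd + (c - t) * ha⟩
      · intro h
        obtain ⟨d, hd⟩ := h.dvd
        push_cast
        exact ⟨r * d - b - m * a, by linear_combination (r : ℤ) * hd - hb - m * ha⟩
    rw [e1]
    constructor
    · rintro ⟨h5, h6⟩
      refine ⟨h6, ?_⟩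
      by_contra hlt
      have := Nat.mul_le_mul_left r (show T + 1 ≤ t by omega)
      rw [mul_add] at this
      omega
    · rintro ⟨h5, h6⟩
      refine ⟨?_, h5⟩
      obtain ⟨d, hd⟩ := e1.2 h5
      -- A negative multiple of N cannot exceed -N, whereas n - (rt + m) ≥ -m > -N.
      by_contra hlt
      have h7 := Nat.mul_le_mul_left r h6
      have h8 : (n : ℤ) - (r * t + m : ℕ) < 0 := by push_cast; omega
      have h9 : -(N : ℤ) < (n : ℤ) - (r * t + m : ℕ) := by omega
      rw [hd] at h8 h9
      have : d < 0 := by nlinarith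
      have : -1 < d := by nlinarith
      omega
  rw [truncCoeff]
  by_cases hT : ((c - m * w) % N).toNat ≤ T
  · rw [if_pos hT, Finset.sum_eq_single ((c - m * w) % N).toNat]
    · rw [if_pos ((hiff _ (by omega)).2 ⟨rfl, hT⟩), mul_one]
    · intro t ht hne
      rw [Finset.mem_range] at ht
      rw [if_neg, mul_zero]
      rw [hiff t ht]
      tauto
    · intro h
      simp at h
      omega
  · rw [if_neg hT]
    apply Finset.sum_eq_zero
    intro t ht
    rw [Finset.mem_range] at ht
    rw [if_neg, mul_zero]
    rw [hiff t ht]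
    rintro ⟨rfl, h⟩
    exact hT h

/-- Every alternating sum of truncated coefficients of the cyclotomic polynomial of `p * q` along
an arithmetic progression is a coefficient of a ternary cyclotomic polynomial. -/
theorem exists_cyclotomicCoeff_eq_sum_truncCoeff {p q : ℕ} (hp : p.Prime) (hq : q.Prime)
    (hpq : p < q) {w : ℤ} (hw : IsCoprime w ((p * q : ℕ) : ℤ)) (c : ℤ) (T : ℕ) :
    ∃ r : ℕ, r.Prime ∧ q < r ∧ ∃ n : ℕ, cyclotomicCoeff (p * q * r) n =
      ∑ m ∈ Finset.range p, (truncCoeff (p * q) T (c - m * w) -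
        truncCoeff (p * q) T (c - (m + q) * w)) := by
  have hp2 := hp.two_le
  have hN : 0 < p * q := Nat.mul_pos hp.pos hq.pos
  have : NeZero (p * q) := ⟨hN.ne'⟩
  obtain ⟨a, b, hab⟩ := hw
  have haw : ((a : ℤ) : ZMod (p * q)) * (w : ℤ) = 1 := by
    rw [← Int.cast_mul, ← Int.cast_one, ZMod.intCast_eq_intCast_iff]
    exact Int.modEq_iff_dvd.2 ⟨b, by linear_combination -hab⟩
  have hunit : IsUnit ((a : ℤ) : ZMod (p * q)) := IsUnit.of_mul_eq_one _ haw
  -- Dirichlet: r is a prime above pq, inverse to w mod pq.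
  obtain ⟨r, hrN, hr, hra⟩ := Nat.forall_exists_prime_gt_and_eq_mod hunit (p * q)
  have hqN : q ≤ p * q := by nlinarith
  have hrw : (r : ℤ) * w ≡ 1 [ZMOD (p * q : ℕ)] := by
    rw [← ZMod.intCast_eq_intCast_iff]
    rw [Int.cast_mul, Int.cast_natCast, hra, haw, Int.cast_one]
  -- This n is the element of [rT, rT + pq) congruent to rc mod pq.
  refine ⟨r, hr, by omega, r * T + ((r * c - r * T) % (p * q : ℕ)).toNat, ?_⟩
  have hN' : (0 : ℤ) < (p * q : ℕ) := by exact_mod_cast hN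
  have h3 := Int.emod_nonneg (r * c - r * T : ℤ) hN'.ne'
  have h4 := Int.emod_lt_of_pos (r * c - r * T : ℤ) hN'
  set n := r * T + ((r * c - r * T) % (p * q : ℕ) : ℤ).toNat with hn
  have hnc : (n : ℤ) ≡ r * c [ZMOD (p * q : ℕ)] := by
    have : (n : ℤ) = r * T + (r * c - r * T) % (p * q : ℕ) := by
      rw [hn, Nat.cast_add, Nat.cast_mul, Int.toNat_of_nonneg h3]
    rw [this]
    refine ((Int.mod_modEq _ _).add_left _).trans ?_
    rw [add_sub_cancel]
  rw [cyclotomicCoeff, coeff_cyclotomic_mul_prime_mul_prime hp hq hr hpq.ne (by omega) (by omega)]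
  simp only [Finset.mul_sum]
  rw [Finset.sum_comm]
  refine Finset.sum_congr rfl fun m hm => ?_
  rw [Finset.mem_range] at hm
  have hmq : m + q < p * q := by nlinarith
  simp only [mul_sub, Finset.sum_sub_distrib]
  rw [← sum_range_coeff_mul_ite hN hrw hnc (show m < p * q by omega) hrN.le (by omega) (by omega),
    ← Nat.cast_add,
    ← sum_range_coeff_mul_ite hN hrw hnc hmq hrN.le (by omega) (by omega)]

/-! ### The two families of progressions -/

theorem sum_range_ite_le_and_lt {a b n : ℕ} (hab : a ≤ b) (hb : b ≤ n) :
    (∑ m ∈ Finset.range n, if a ≤ m ∧ m < b then (1 : ℤ) else 0) = b - a := by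
  rw [Finset.sum_boole, ← Nat.cast_sub hab, ← Nat.card_Ico a b]
  congr 2
  ext m
  simp only [Finset.mem_filter, Finset.mem_range, Finset.mem_Ico]
  omega

theorem exists_mul_mem_Ioc (a : ℤ) {b : ℤ} (hb : 0 < b) : ∃ d : ℤ, a < d * b ∧ d * b ≤ a + b := by
  refine ⟨a / b + 1, ?_, ?_⟩
  · have := Int.lt_ediv_add_one_mul_self a hb
    linarith
  · have := Int.ediv_mul_le a hb.ne'
    linarith

theorem isCoprime_sub_mul_mul {p q : ℕ} (hp : p.Prime) (hq : q.Prime) (hpq : p ≠ q) {d : ℤ}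
    (hd0 : 0 < d) (hdq : d < q) : IsCoprime ((q : ℤ) - d * p) ((p * q : ℕ) : ℤ) := by
  have hco : IsCoprime (p : ℤ) q := Nat.isCoprime_iff_coprime.2 ((Nat.coprime_primes hp hq).2 hpq)
  have hd : IsCoprime d (q : ℤ) := by
    refine ((Nat.prime_iff_prime_int.1 hq).coprime_iff_not_dvd.2 fun h => ?_).symm
    exact absurd (Int.le_of_dvd hd0 h) (by omega)
  rw [Nat.cast_mul]
  apply IsCoprime.mul_right
  · rw [show (q : ℤ) - d * p = q + p * (-d) by ring]
    exact hco.symm.add_mul_left_left _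
  · rw [show (q : ℤ) - d * p = -(d * p) + q * 1 by ring]
    exact (hd.mul_left hco).neg_left.add_mul_left_left _

/-- Here l = 2k + 1 and w = q - dp. The subtracted progression meets -1 exactly 3k + 4 times; the
other one meets only zeros. -/
theorem exists_cyclotomicCoeff_eq_of_eq_six_mul_add_five {p q k s : ℕ} (hp : p.Prime)
    (hq : q.Prime) (hk : 1 ≤ k) (hpk : p = 6 * k + 5) (hqs : q = p * s + (3 * k + 1))
    (hpq : p * p < q) :
    ∃ r : ℕ, r.Prime ∧ q < r ∧ ∃ n : ℕ, cyclotomicCoeff (p * q * r) n = 3 * k + 4 := by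
  have hpq' : p < q := lt_of_le_of_lt (Nat.le_mul_self p) hpq
  -- The lower bound on d gives (5k+1)w < (3k+1)q; the upper one gives μ + d(5k+1) < q. The
  -- hypothesis q > p² leaves room for a multiple of p(5k+1) in between.
  obtain ⟨d, hd1, hd2⟩ := exists_mul_mem_Ioc (2 * k * q) (b := p * (5 * k + 1))
    (mul_pos (by exact_mod_cast hp.pos) (by positivity))
  have hpz : (p : ℤ) = 6 * k + 5 := by exact_mod_cast hpk
  have hqz : (q : ℤ) = p * s + (3 * k + 1) := by exact_mod_cast hqs
  have hkz : (1 : ℤ) ≤ k := by exact_mod_cast hk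
  have hpqz : (p : ℤ) * p < q := by exact_mod_cast hpq
  have hp0 : (0 : ℤ) < p := by exact_mod_cast hp.pos
  have hq0 : (0 : ℤ) < q := by exact_mod_cast hq.pos
  have hq1 : (1 : ℤ) < q := by exact_mod_cast hq.one_lt
  have hp1 : (1 : ℤ) < p := by exact_mod_cast hp.one_lt
  have hd2 : d * p * (5 * k + 1) ≤ (2 * k + 1) * q - 1 - p := by
    have : (p : ℤ) * (5 * k + 1) + 1 + p ≤ p * p := by nlinarith
    linarith
  have hd1 : 2 * k * q < d * p * (5 * k + 1) := by linarith
  have hk5 : (0 : ℤ) < 5 * k + 1 := by omega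
  have hkq : 1 * (q : ℤ) ≤ k * q := mul_le_mul_of_nonneg_right hkz hq0.le
  have hD0 : 0 < d * p :=
    (pos_iff_pos_of_mul_pos (lt_of_le_of_lt (by positivity) hd1)).2 hk5
  have hd0 : 0 < d := (pos_iff_pos_of_mul_pos hD0).2 hp0
  have hDq : d * p < q :=
    lt_of_mul_lt_mul_right (by linarith only [hd2, hkq, hq1, hp1]) hk5.le
  have hdq : d < q := lt_of_le_of_lt (le_mul_of_one_le_right hd0.le hp1.le) hDq
  obtain ⟨μ, hμ⟩ : ∃ μ : ℕ, q = μ + ((2 * k + 1) * s + k) :=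
    Nat.exists_eq_add_of_le' (hqs ▸ Nat.add_le_add (Nat.mul_le_mul_right s (by omega)) (by omega))
  have hμq : μ ≤ q := by omega
  have hμ0 : (0 : ℤ) ≤ μ := Nat.cast_nonneg μ
  have hμz : (μ : ℤ) * p = (4 * k + 4) * q + 1 := by
    have : (q : ℤ) = μ + ((2 * k + 1) * s + k) := by exact_mod_cast hμ
    have e : (μ : ℤ) = q - ((2 * k + 1) * s + k) := by linarith
    rw [e]
    linear_combination (q - k : ℤ) * hpz + (2 * k + 1) * hqz
  have hrel : μ * p + (2 * k + 1) * q = p * q + 1 := by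
    zify
    rw [hμz, hpz]; ring
  have hl : 2 * k + 1 ≤ p := by omega
  obtain ⟨w, hw⟩ : ∃ w : ℤ, w = q - d * p := ⟨_, rfl⟩
  have hw0 : 0 < w := by linarith
  have hwq : w < q := by linarith
  have hwlast : (5 * k + 1) * w < (3 * k + 1) * q := by rw [hw]; linarith
  have hi : ∀ h : ℤ, h ≤ 5 * k + 1 → μ + d * h < q := by
    intro h hh
    have h1 : d * p * h ≤ d * p * (5 * k + 1) := mul_le_mul_of_nonneg_left hh hD0.le
    have h2 : (μ + d * h) * p < q * p := by
      have : (q : ℤ) * p = (6 * k + 5) * q := by rw [hpz]; ring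
      linarith only [this, h1, hd2, hμz, hp0]
    exact lt_of_mul_lt_mul_right h2 hp0.le
  have hi' : ∀ h : ℤ, h ≤ k + 3 → 0 ≤ μ - d * h := by
    intro h hh
    have h1 : d * p * h ≤ d * p * (5 * k + 1) := mul_le_mul_of_nonneg_left (by omega) hD0.le
    have h2 : 0 * p ≤ (μ - d * h) * p := by linarith only [h1, hd2, hμz, hkq, hp0, hq0]
    exact le_of_mul_le_mul_right h2 hp0
  -- T = μp + (5k+4)q - pq is a point of the negative quadrant, at its edge i = μ.
  obtain ⟨T, hT⟩ : ∃ T : ℕ, T = 1 + (3 * k + 3) * q := ⟨_, rfl⟩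
  have hTz : (T : ℤ) = 1 + (3 * k + 3) * q := by rw [hT]; push_cast; ring
  have hN : ((p * q : ℕ) : ℤ) = (6 * k + 5) * q := by rw [Nat.cast_mul, hpz]
  obtain ⟨r, hr, hqr, n, hn⟩ := exists_cyclotomicCoeff_eq_sum_truncCoeff hp hq hpq'
    (hw ▸ isCoprime_sub_mul_mul hp hq hpq'.ne hd0 hdq) (T + (3 * k + 1) * q + (k + 3) * w) T
  refine ⟨r, hr, hqr, n, ?_⟩
  rw [hn]
  have hterm : ∀ m ∈ Finset.range p,
      truncCoeff (p * q) T (T + (3 * k + 1) * q + (k + 3) * w - m * w) -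
        truncCoeff (p * q) T (T + (3 * k + 1) * q + (k + 3) * w - (m + q) * w) =
      if k + 3 ≤ m ∧ m < 4 * k + 7 then 1 else 0 := by
    intro m hm
    rw [Finset.mem_range] at hm
    -- The offset c makes the second progression pass through T at h = 0; h runs from -(k+3) to 5k +
    -- 1.
    obtain ⟨h, hh⟩ : ∃ h : ℤ, h = m - (k + 3) := ⟨_, rfl⟩
    have hm1 : h ≤ 5 * k + 1 := by omega
    have hm2 : -h ≤ k + 3 := by omega
    have e1 : (T + (3 * k + 1) * q + (k + 3) * w - m * w : ℤ) = T + (3 * k + 1) * q - h * w := by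
      rw [hh]; ring
    have e2 : (T + (3 * k + 1) * q + (k + 3) * w - (m + q) * w : ℤ) ≡ T - h * w
        [ZMOD (p * q : ℕ)] := by
      rw [Nat.cast_mul]
      -- Modulo pq, qw ≡ q² ≡ (3k+1)q.
      exact Int.modEq_iff_dvd.2 ⟨s - d, by rw [hh, hw]; linear_combination (q : ℤ) * hqz⟩
    have z1 : truncCoeff (p * q) T (T + (3 * k + 1) * q - h * w) = 0 := by
      -- For h ≥ 0 the term lies strictly between T and pq; for h < 0 it falls in a mixed quadrant.
      rcases le_or_gt 0 h with h0 | h0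
      · have h1 : h * w ≤ (5 * k + 1) * w := mul_le_mul_of_nonneg_right hm1 hw0.le
        have h2 : 0 ≤ h * w := mul_nonneg h0 hw0.le
        apply truncCoeff_eq_zero_of_lt
        · linarith only [h1, hwlast]
        · rw [hN, hTz]; linarith only [h2, hq1]
      · have h1 : d * h ≤ d * -1 := mul_le_mul_of_nonneg_left (by omega) hd0.le
        apply truncCoeff_eq_zero hp hq hpq'.ne hμq hl hrel (i := μ + d * h) (j := 2 * k - h)
        · have hm3 := hi' (-h) hm2
          have hμq' : (μ : ℤ) ≤ q := by exact_mod_cast hμq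
          constructor <;> linarith only [h1, hd0, hm3, hμq']
        · omega
        · refine Int.modEq_iff_dvd.2 ⟨0, ?_⟩
          rw [hTz, hw]
          linear_combination hμz
        · left; push_cast; constructor <;> linarith only [h1, hd0, h0]
    have z2 : truncCoeff (p * q) T (T - h * w) =
        -(if k + 3 ≤ m ∧ m < 4 * k + 7 then 1 else 0) := by
      rcases lt_or_ge h 0 with h0 | h0
      · have h1 : 0 < -h * w := mul_pos (by omega) hw0
        have h2 : -h * w ≤ (k + 3) * w := mul_le_mul_of_nonneg_right hm2 hw0.le
        have h3 : (k + 3) * w ≤ (k + 3) * q := mul_le_mul_of_nonneg_left hwq.le (by omega)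
        have h4 : (1 : ℤ) * q ≤ k * q := mul_le_mul_of_nonneg_right hkz hq0.le
        rw [if_neg (by omega), truncCoeff_eq_zero_of_lt]
        · simp
        · linarith only [h1]
        · rw [hN, hTz]; linarith only [h2, h3, h4, hq1]
      · have h1 : 0 ≤ d * h := mul_nonneg hd0.le h0
        have h2 := hi h hm1
        have h3 : 0 ≤ h * w := mul_nonneg h0 hw0.le
        -- The coordinate j = 5k + 4 - h stays at or above l = 2k + 1 exactly for h < 3k + 4.
        by_cases hlt : h < 3 * k + 4
        · rw [if_pos (by omega)]
          apply truncCoeff_eq_neg_one hp hq hpq'.ne hμq hl hrel (i := μ + d * h)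
            (j := 5 * k + 4 - h)
          · constructor <;> linarith only [h1, h2]
          · omega
          · rw [hTz, hw]
            linear_combination (q : ℤ) * hpz - hμz
          · linarith only [h3]
        · rw [if_neg (by omega), neg_zero]
          apply truncCoeff_eq_zero hp hq hpq'.ne hμq hl hrel (i := μ + d * h)
            (j := 5 * k + 4 - h)
          · constructor <;> linarith only [h1, h2, hμ0]
          · omega
          · refine Int.modEq_iff_dvd.2 ⟨1, ?_⟩
            rw [hTz, hw]
            linear_combination hμz - (q : ℤ) * hpz
          · right; push_cast; constructor <;> linarith only [h1, hlt]
    rw [e1, truncCoeff_congr e2, z1, z2]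
    ring
  rw [Finset.sum_congr rfl hterm, sum_range_ite_le_and_lt (by omega) (by omega)]
  push_cast
  ring

/-- Here l = 4k and the step is -w with w = q - dp. The roles are exchanged: the first progression
meets 1 exactly 3k + 2 times, and the subtracted one meets only zeros. -/
theorem exists_cyclotomicCoeff_eq_of_eq_six_mul_add_one {p q k s : ℕ} (hp : p.Prime)
    (hq : q.Prime) (hk : 2 ≤ k) (hpk : p = 6 * k + 1) (hqs : q + 1 = p * s + 3 * k)
    (hpq : p * p < q) :
    ∃ r : ℕ, r.Prime ∧ q < r ∧ ∃ n : ℕ, cyclotomicCoeff (p * q * r) n = 3 * k + 2 := by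
  have hpq' : p < q := lt_of_le_of_lt (Nat.le_mul_self p) hpq
  have hkz : (2 : ℤ) ≤ k := by exact_mod_cast hk
  have hp0 : (0 : ℤ) < p := by exact_mod_cast hp.pos
  have hq0 : (0 : ℤ) < q := by exact_mod_cast hq.pos
  have hq1 : (1 : ℤ) < q := by exact_mod_cast hq.one_lt
  have hp1 : (1 : ℤ) < p := by exact_mod_cast hp.one_lt
  -- The bounds on d amount to (5k-1)w < (3k-1)q and d(5k-1) < μ.
  obtain ⟨d, hd1, hd2⟩ := exists_mul_mem_Ioc (2 * k * q) (b := p * (5 * k - 1))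
    (mul_pos hp0 (by omega))
  have hpz : (p : ℤ) = 6 * k + 1 := by exact_mod_cast hpk
  have hqz : (q : ℤ) = p * s + (3 * k - 1) := by
    have : (q : ℤ) + 1 = p * s + 3 * k := by exact_mod_cast hqs
    linarith
  have hpqz : (p : ℤ) * p < q := by exact_mod_cast hpq
  have hd2 : d * p * (5 * k - 1) ≤ (2 * k + 1) * q + 1 - p := by
    have : (p : ℤ) * (5 * k - 1) + p ≤ p * p := by nlinarith
    linarith
  have hd1 : 2 * k * q < d * p * (5 * k - 1) := by linarith
  have hk5 : (0 : ℤ) < 5 * k - 1 := by omega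
  have hkq : 2 * (q : ℤ) ≤ k * q := mul_le_mul_of_nonneg_right hkz hq0.le
  have hD0 : 0 < d * p :=
    (pos_iff_pos_of_mul_pos (lt_of_le_of_lt (by positivity) hd1)).2 hk5
  have hd0 : 0 < d := (pos_iff_pos_of_mul_pos hD0).2 hp0
  have hDq : d * p < q :=
    lt_of_mul_lt_mul_right (by linarith only [hd2, hkq, hq1, hp1]) hk5.le
  have hdq : d < q := lt_of_le_of_lt (le_mul_of_one_le_right hd0.le hp1.le) hDq
  obtain ⟨μ, hμ⟩ : ∃ μ : ℕ, q + 1 = μ + (4 * k * s + 2 * k) :=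
    Nat.exists_eq_add_of_le' (hqs ▸ Nat.add_le_add (Nat.mul_le_mul_right s (by omega)) (by omega))
  have hμz : (μ : ℤ) * p = (2 * k + 1) * q + 1 := by
    have : (q : ℤ) + 1 = μ + (4 * k * s + 2 * k) := by exact_mod_cast hμ
    have e : (μ : ℤ) = q + 1 - (4 * k * s + 2 * k) := by linarith
    rw [e]
    linear_combination (q + 1 - 2 * k : ℤ) * hpz + 4 * k * hqz
  have hμq : μ ≤ q := by omega
  have hμ0 : (0 : ℤ) ≤ μ := Nat.cast_nonneg μ
  have hrel : μ * p + 4 * k * q = p * q + 1 := by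
    zify
    rw [hμz, hpz]; ring
  have hl : 4 * k ≤ p := by omega
  obtain ⟨w, hw⟩ : ∃ w : ℤ, w = q - d * p := ⟨_, rfl⟩
  have hw0 : 0 < w := by linarith
  have hwq : w < q := by linarith
  have hwlast : (5 * k - 1) * w < (3 * k - 1) * q := by rw [hw]; linarith
  have hi : ∀ h : ℤ, h ≤ 5 * k - 1 → d * h < μ := by
    intro h hh
    have h1 : d * p * h ≤ d * p * (5 * k - 1) := mul_le_mul_of_nonneg_left hh hD0.le
    have h2 : (d * h) * p < μ * p := by linarith only [h1, hd2, hμz, hp0]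
    exact lt_of_mul_lt_mul_right h2 hp0.le
  have hi' : ∀ h : ℤ, h ≤ k + 1 → μ ≤ q - d * h := by
    intro h hh
    have h1 : d * p * h ≤ d * p * (5 * k - 1) := mul_le_mul_of_nonneg_left (by omega) hD0.le
    have h2 : μ * p ≤ (q - d * h) * p := by
      have : (q : ℤ) * p = (6 * k + 1) * q := by rw [hpz]; ring
      linarith only [this, h1, hd2, hμz, hkq, hp1, hq1]
    exact le_of_mul_le_mul_right h2 hp0
  obtain ⟨T, hT⟩ : ∃ T : ℕ, T = (3 * k + 1) * q := ⟨_, rfl⟩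
  have hTz : (T : ℤ) = (3 * k + 1) * q := by rw [hT]; push_cast; ring
  have hN : ((p * q : ℕ) : ℤ) = (6 * k + 1) * q := by rw [Nat.cast_mul, hpz]
  obtain ⟨r, hr, hqr, n, hn⟩ := exists_cyclotomicCoeff_eq_sum_truncCoeff hp hq hpq'
    (hw ▸ (isCoprime_sub_mul_mul hp hq hpq'.ne hd0 hdq).neg_left) (T - (5 * k - 1) * w) T
  refine ⟨r, hr, hqr, n, ?_⟩
  rw [hn]
  have hterm : ∀ m ∈ Finset.range p,
      truncCoeff (p * q) T (T - (5 * k - 1) * w - m * -w) -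
        truncCoeff (p * q) T (T - (5 * k - 1) * w - (m + q) * -w) =
      if 2 * k - 2 ≤ m ∧ m < 5 * k then 1 else 0 := by
    intro m hm
    rw [Finset.mem_range] at hm
    -- Now h decreases as m grows, from 5k - 1 to -(k+1), and h = 0 puts the first progression at T.
    obtain ⟨h, hh⟩ : ∃ h : ℤ, h = 5 * k - 1 - m := ⟨_, rfl⟩
    have hm1 : h ≤ 5 * k - 1 := by omega
    have hm2 : -h ≤ k + 1 := by omega
    have e1 : (T - (5 * k - 1) * w - m * -w : ℤ) = T - h * w := by
      rw [hh]; ring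
    have e2 : (T - (5 * k - 1) * w - (m + q) * -w : ℤ) ≡ T + (3 * k - 1) * q - h * w
        [ZMOD (p * q : ℕ)] := by
      rw [Nat.cast_mul]
      exact Int.modEq_iff_dvd.2 ⟨d - s, by rw [hh, hw]; linear_combination (-q : ℤ) * hqz⟩
    have z1 : truncCoeff (p * q) T (T + (3 * k - 1) * q - h * w) = 0 := by
      rcases le_or_gt 0 h with h0 | h0
      · have h1 : h * w ≤ (5 * k - 1) * w := mul_le_mul_of_nonneg_right hm1 hw0.le
        have h2 : 0 ≤ h * w := mul_nonneg h0 hw0.le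
        apply truncCoeff_eq_zero_of_lt
        · linarith only [h1, hwlast]
        · rw [hN, hTz]; linarith only [h2, hq1]
      · have h1 : d * h ≤ d * -1 := mul_le_mul_of_nonneg_left (by omega) hd0.le
        have h2 := hi' (-h) hm2
        apply truncCoeff_eq_zero hp hq hpq'.ne hμq hl hrel (i := q + d * h) (j := -h - 1)
        · constructor <;> linarith only [h1, h2, hd0, hμ0]
        · omega
        · refine Int.modEq_iff_dvd.2 ⟨0, ?_⟩
          rw [hTz, hw]
          linear_combination (q : ℤ) * hpz
        · right; push_cast; constructor <;> linarith only [h2, hm2, hkz]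
    have z2 : truncCoeff (p * q) T (T - h * w) =
        if 2 * k - 2 ≤ m ∧ m < 5 * k then 1 else 0 := by
      rcases lt_or_ge h 0 with h0 | h0
      · have h1 : 0 < -h * w := mul_pos (by omega) hw0
        have h2 : -h * w ≤ (k + 1) * w := mul_le_mul_of_nonneg_right hm2 hw0.le
        have h3 : (k + 1) * w ≤ (k + 1) * q := mul_le_mul_of_nonneg_left hwq.le (by omega)
        have h4 : (2 : ℤ) * q ≤ k * q := mul_le_mul_of_nonneg_right hkz hq0.le
        rw [if_neg (by omega), truncCoeff_eq_zero_of_lt]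
        · linarith only [h1]
        · rw [hN, hTz]; linarith only [h2, h3, h4, hq1]
      · have h1 : 0 ≤ d * h := mul_nonneg hd0.le h0
        have h2 := hi h hm1
        have h3 : 0 ≤ h * w := mul_nonneg h0 hw0.le
        by_cases hlt : h < 3 * k + 2
        · rw [if_pos (by omega)]
          -- At h = 0 the bound j < l reads 3k + 1 < 4k, which needs k ≥ 2 and so excludes p = 7.
          apply truncCoeff_eq_one hp hq hpq'.ne hμq hl hrel (i := d * h) (j := 3 * k + 1 - h)
          · exact ⟨h1, h2⟩
          · omega
          · rw [hTz, hw]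
            ring
          · linarith only [h3]
        · rw [if_neg (by omega)]
          -- Once 3k + 1 - h is negative, j wraps around by p = 6k + 1 and lands above l.
          apply truncCoeff_eq_zero hp hq hpq'.ne hμq hl hrel (i := d * h) (j := 9 * k + 2 - h)
          · exact ⟨h1, h2.trans_le (by exact_mod_cast hμq)⟩
          · omega
          · refine Int.modEq_iff_dvd.2 ⟨1, ?_⟩
            rw [hTz, hw]
            linear_combination -(q : ℤ) * hpz
          · left; push_cast; constructor <;> linarith only [h2, hm1, hkz]
    rw [e1, truncCoeff_congr e2, z1, z2]
    ring
  rw [Finset.sum_congr rfl hterm, sum_range_ite_le_and_lt (by omega) (by omega)]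
  rw [Nat.cast_sub (by omega)]
  push_cast
  ring

/-! ### Choice of q and conclusion -/

theorem exists_prime_eq_mul_add {p b : ℕ} (hp : p.Prime) (hb0 : 0 < b) (hbp : b < p) (N : ℕ) :
    ∃ q s : ℕ, q.Prime ∧ N < q ∧ q = p * s + b := by
  have : NeZero p := ⟨hp.ne_zero⟩
  have hu : IsUnit (b : ZMod p) :=
    (ZMod.isUnit_iff_coprime b p).2 (Nat.coprime_of_lt_prime hb0.ne' hbp hp).symm
  obtain ⟨q, hqN, hq, hqb⟩ := Nat.forall_exists_prime_gt_and_eq_mod hu N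
  rw [ZMod.natCast_eq_natCast_iff', Nat.mod_eq_of_lt hbp] at hqb
  exact ⟨q, q / p, hq, hqN, by rw [← hqb, Nat.div_add_mod]⟩

theorem exists_cyclotomicCoeff_eq_add_three_div_two {p : ℕ} (hp : p.Prime) (h11 : 11 ≤ p) :
    ∃ q r : ℕ, q.Prime ∧ r.Prime ∧ p < q ∧ q < r ∧
      ∃ k : ℕ, (cyclotomicCoeff (p * q * r) k : ℚ) = ((p : ℚ) + 3) / 2 := by
  have h2 : ¬ 2 ∣ p := fun h => by
    have := (Nat.prime_dvd_prime_iff_eq Nat.prime_two hp).1 h; omega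
  have h3 : ¬ 3 ∣ p := fun h => by
    have := (Nat.prime_dvd_prime_iff_eq Nat.prime_three hp).1 h; omega
  have h6 : p = 6 * (p / 6) + 1 ∨ p = 6 * (p / 6) + 5 := by omega
  obtain ⟨k, hk⟩ : ∃ k, k = p / 6 := ⟨_, rfl⟩
  rw [← hk] at h6
  rcases h6 with h6 | h6
  · obtain ⟨q, s, hq, hpq, hqs⟩ :=
      exists_prime_eq_mul_add (b := 3 * k - 1) hp (by omega) (by omega) (p * p)
    obtain ⟨r, hr, hqr, n, hn⟩ := exists_cyclotomicCoeff_eq_of_eq_six_mul_add_one hp hq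
      (by omega) h6 (s := s) (by omega) hpq
    refine ⟨q, r, hq, hr, lt_of_le_of_lt (Nat.le_mul_self p) hpq, hqr, n, ?_⟩
    rw [hn, h6]
    push_cast
    ring
  · obtain ⟨q, s, hq, hpq, hqs⟩ :=
      exists_prime_eq_mul_add (b := 3 * k + 1) hp (by omega) (by omega) (p * p)
    obtain ⟨r, hr, hqr, n, hn⟩ := exists_cyclotomicCoeff_eq_of_eq_six_mul_add_five hp hq
      (by omega) h6 (s := s) (by omega) hpq
    refine ⟨q, r, hq, hr, lt_of_le_of_lt (Nat.le_mul_self p) hpq, hqr, n, ?_⟩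
    rw [hn, h6]
    push_cast
    ring

theorem mainTheorem3 (p : ℕ) (hp : p.Prime) (h11 : 11 ≤ p) :
    ¬ SisterBeiterConjecture p ∧
      ∃ q r : ℕ, q.Prime ∧ r.Prime ∧ p < q ∧ q < r ∧
        ∃ k : ℕ, (cyclotomicCoeff (p * q * r) k : ℚ) = ((p : ℚ) + 3) / 2 := by
  have hex := exists_cyclotomicCoeff_eq_add_three_div_two hp h11
  refine ⟨fun hconj => ?_, hex⟩
  obtain ⟨q, r, hq, hr, hpq, hqr, k, hk⟩ := hex
  have hle := (le_abs_self _).trans (hconj q r hq hr hpq hqr k)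
  rw [hk] at hle
  linarith
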